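/- A nonsymmetric operad in the category of sets is a graded set $\mathcal{O}=\bigsqcup_{n\ge 1}\mathcal{O}(n)$ with a unit in $\mathcal{O}(1)$ and partial compositions $\circ_i:\mathcal{O}(n)\times\mathcal{O}(m)\to\mathcal{O}(n+m-1)$, $1\le i\le n$, satisfying the usual associativity and unit axioms; when all $\mathcal{O}(n)$ are finite, its Hilbert series is $\mathcal{H}_{\mathcal{O}}(t)=\sum_{n\ge 1}\#\mathcal{O}(n)\,t^n$. Let $\mathbf{Mag}$ be the magmatic operad: $\mathbf{Mag}(n)$ is the set of binary trees with $n$ leaves, the unit is the leaf, and $\mathfrak{t}\circ_i\mathfrak{s}$ is obtained by grafting the root of $\mathfrak{s}$ onto the $i$-th leaf of $\mathfrak{t}$. Let $\mathbf{CAs}_3$ be the quotient of $\mathbf{Mag}$ by the smallest operad congruence (arity-preserving equivalence relation compatible with all partial compositions) that identifies the left comb and the right comb with $3$ internal nodes. **Proposition.** All the sets $\mathbf{CAs}_3(n)$ are finite, and the Hilbert series of $\mathbf{CAs}_3$ is $$\mathcal{H}_{\mathbf{CAs}_3}(t)=\frac{t}{(1-t)^2}\left(1-t+t^2+t^3+2t^4+2t^5-7t^7-2t^8+t^9+2t^{10}+t^{11}\right).$$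 Hence, for every $n\ge 11$, $\#\mathbf{CAs}_3(n)=n+3$; equivalently, for every field $\mathbb{K}$ of characteristic zero, the linear span $\mathbb{K}\langle\mathbf{CAs}_3(n)\rangle$ has dimension $n+3$. -/

import Mathlib

universe u

/-! ### Nonsymmetric operads in the category of sets -/

/-- A nonsymmetric operad in the category of sets: a graded set `⨆ n ≥ 1, O(n)`, given as a type
with an arity function, a unit of arity `1`, and partial compositions `comp x i y = x ∘ᵢ y`.
The composition `x ∘ᵢ y` is meaningful for `1 ≤ i ≤ |x|` only, and all laws are restricted to
such indices; outside this range the value of `comp` is junk. -/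
structure NSOperad where
  carrier : Type u
  arity : carrier → ℕ
  one_le_arity : ∀ x, 1 ≤ arity x
  unit : carrier
  arity_unit : arity unit = 1
  comp : carrier → ℕ → carrier → carrier
  arity_comp : ∀ x i y, 1 ≤ i → i ≤ arity x → arity (comp x i y) = arity x + arity y - 1
  comp_nested : ∀ x y z i j, 1 ≤ i → i ≤ arity x → 1 ≤ j → j ≤ arity y →
    comp (comp x i y) (i + j - 1) z = comp x i (comp y j z)
  comp_disjoint : ∀ x y z i j, 1 ≤ i → i < j → j ≤ arity x →
    comp (comp x i y) (j + arity y - 1) z = comp (comp x j z) i y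
  unit_comp : ∀ x, comp unit 1 x = x
  comp_unit : ∀ x i, 1 ≤ i → i ≤ arity x → comp x i unit = x

namespace NSOperad

/-- The set `O(n)` of the elements of arity `n` of an operad `O`. -/
def component (O : NSOperad.{u}) (n : ℕ) : Type u := {x : O.carrier // O.arity x = n}

/-- The Hilbert series `∑_{n ≥ 1} #O(n) tⁿ`, for an operad all of whose components are finite
(there is no element of arity `0`, so the coefficient of index `0` vanishes). -/
noncomputable def hilbertSeries (O : NSOperad.{u}) : PowerSeries ℚ :=
  PowerSeries.mk fun n => (Nat.card (O.component n) : ℚ)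

/-- An operad congruence: an arity-preserving equivalence relation that is compatible with the
partial compositions. -/
structure Congruence (O : NSOperad.{u}) where
  rel : O.carrier → O.carrier → Prop
  equivalence : Equivalence rel
  arity_eq : ∀ {x x'}, rel x x' → O.arity x = O.arity x'
  comp_rel : ∀ {x x' y y'} (i : ℕ), 1 ≤ i → i ≤ O.arity x → rel x x' → rel y y' →
    rel (O.comp x i y) (O.comp x' i y')

namespace Congruence

variable {O : NSOperad.{u}}

/-- The equivalence relation underlying a congruence. -/
def toSetoid (c : O.Congruence) : Setoid O.carrier := ⟨c.rel, c.equivalence⟩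

open Classical in
/-- The quotient operad `O/c`: the equivalence classes of `c` with `[x] ∘ᵢ [y] = [x ∘ᵢ y]`
for `1 ≤ i ≤ |x|`. -/
noncomputable def quotient (c : O.Congruence) : NSOperad.{u} where
  carrier := Quotient c.toSetoid
  arity := Quotient.lift O.arity fun _ _ h => c.arity_eq h
  one_le_arity := by
    rintro ⟨x⟩
    exact O.one_le_arity x
  unit := Quotient.mk c.toSetoid O.unit
  arity_unit := O.arity_unit
  comp q i q' := Quotient.liftOn₂ q q'
    (fun x y => Quotient.mk c.toSetoid (if 1 ≤ i ∧ i ≤ O.arity x then O.comp x i y else x))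
    (by
      intro x y x' y' hx hy
      apply Quotient.sound
      have ha : O.arity x = O.arity x' := c.arity_eq hx
      by_cases hi : 1 ≤ i ∧ i ≤ O.arity x
      · have hi' : 1 ≤ i ∧ i ≤ O.arity x' := ha ▸ hi
        simp only [hi, hi', and_self, if_true]
        exact c.comp_rel i hi.1 hi.2 hx hy
      · have hi' : ¬ (1 ≤ i ∧ i ≤ O.arity x') := ha ▸ hi
        simp only [hi, hi', if_false]
        exact hx)
  arity_comp := by
    rintro ⟨x⟩ i ⟨y⟩ h1 h2
    change 1 ≤ i at h1
    change i ≤ O.arity x at h2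
    change O.arity (if 1 ≤ i ∧ i ≤ O.arity x then O.comp x i y else x) = _
    rw [if_pos ⟨h1, h2⟩]
    exact O.arity_comp x i y h1 h2
  comp_nested := by
    rintro ⟨x⟩ ⟨y⟩ ⟨z⟩ i j h1 h2 h3 h4
    change i ≤ O.arity x at h2
    change j ≤ O.arity y at h4
    have h5 := O.arity_comp x i y h1 h2
    refine congrArg (Quotient.mk c.toSetoid) ?_
    rw [if_pos (And.intro h1 h2), if_pos (And.intro h3 h4), if_pos ⟨by omega, by omega⟩,
      if_pos (And.intro h1 h2)]
    exact O.comp_nested x y z i j h1 h2 h3 h4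
  comp_disjoint := by
    rintro ⟨x⟩ ⟨y⟩ ⟨z⟩ i j h1 h2 h3
    change j ≤ O.arity x at h3
    have hy := O.one_le_arity y
    have hz := O.one_le_arity z
    have h5 := O.arity_comp x i y h1 (by omega)
    have h6 := O.arity_comp x j z (by omega) h3
    refine congrArg (Quotient.mk c.toSetoid) ?_
    change (if 1 ≤ j + O.arity y - 1 ∧ j + O.arity y - 1 ≤ O.arity _ then
      O.comp _ (j + O.arity y - 1) z else _) = _
    rw [if_pos (And.intro h1 (by omega : i ≤ O.arity x)),
      if_pos (And.intro (by omega : 1 ≤ j) h3),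
      if_pos ⟨by omega, by omega⟩, if_pos ⟨by omega, by omega⟩]
    exact O.comp_disjoint x y z i j h1 h2 h3
  unit_comp := by
    rintro ⟨x⟩
    refine congrArg (Quotient.mk c.toSetoid) ?_
    rw [if_pos ⟨le_refl _, O.arity_unit.ge⟩]
    exact O.unit_comp x
  comp_unit := by
    rintro ⟨x⟩ i h1 h2
    change i ≤ O.arity x at h2
    refine congrArg (Quotient.mk c.toSetoid) ?_
    rw [if_pos ⟨h1, h2⟩]
    exact O.comp_unit x i h1 h2

/-- The smallest operad congruence that contains a given arity-preserving relation: the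
intersection of all the congruences containing it. -/
def generate (O : NSOperad.{u}) (r : O.carrier → O.carrier → Prop)
    (hr : ∀ x y, r x y → O.arity x = O.arity y) : O.Congruence where
  rel x y := ∀ c : O.Congruence, (∀ a b, r a b → c.rel a b) → c.rel x y
  equivalence :=
    ⟨fun x c _ => c.equivalence.refl x, fun h c hc => c.equivalence.symm (h c hc),
      fun h h' c hc => c.equivalence.trans (h c hc) (h' c hc)⟩
  arity_eq {x x'} h :=
    h ⟨fun a b => O.arity a = O.arity b,
      ⟨fun _ => rfl, fun h => h.symm, fun h h' => h.trans h'⟩, fun h => h,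
      fun {x x' y y'} i h1 h2 hx hy => by
        rw [O.arity_comp x i y h1 h2, O.arity_comp x' i y' h1 (hx ▸ h2), hx, hy]⟩ hr
  comp_rel i h1 h2 hx hy c hc := c.comp_rel i h1 h2 (hx c hc) (hy c hc)

theorem generate_of {r : O.carrier → O.carrier → Prop}
    {hr : ∀ x y, r x y → O.arity x = O.arity y} {x y : O.carrier} (h : r x y) :
    (generate O r hr).rel x y :=
  fun _ hc => hc x y h

theorem generate_le {r : O.carrier → O.carrier → Prop}
    {hr : ∀ x y, r x y → O.arity x = O.arity y} (c : O.Congruence)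
    (hc : ∀ a b, r a b → c.rel a b) {x y : O.carrier} (h : (generate O r hr).rel x y) :
    c.rel x y :=
  h c hc

end Congruence

end NSOperad

/-! ### The magmatic operad and the comb associative operads -/

namespace BinaryTree

/-- `graft t i s` is the binary tree obtained by grafting the root of `s` onto the `i`-th leaf of
`t`, the leaves being numbered from left to right starting from `1` (and it is `t` if there is no
such leaf). -/
def graft : BinaryTree Unit → ℕ → BinaryTree Unit → BinaryTree Unit
  | nil, i, s => if i = 1 then s else nil
  | node _ l r, i, s =>
    if i ≤ l.numLeaves then node () (graft l i s) r
    else node () l (graft r (i - l.numLeaves) s)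

theorem numLeaves_graft (t : BinaryTree Unit) (i : ℕ) (s : BinaryTree Unit) (h1 : 1 ≤ i)
    (h2 : i ≤ t.numLeaves) : (graft t i s).numLeaves = t.numLeaves + s.numLeaves - 1 := by
  induction t generalizing i with
  | nil =>
    have : i = 1 := le_antisymm h2 h1
    simp [graft, this]
  | node v l r hl hr =>
    have := l.numLeaves_pos
    have := r.numLeaves_pos
    simp only [numLeaves] at h2
    by_cases h : i ≤ l.numLeaves
    · simp only [graft, if_pos h, numLeaves, hl i h1 h]
      omega
    · simp only [graft, if_neg h, numLeaves, hr (i - l.numLeaves) (by omega) (by omega)]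
      omega

theorem graft_nested (x y z : BinaryTree Unit) (i j : ℕ) (h1 : 1 ≤ i) (h2 : i ≤ x.numLeaves)
    (h3 : 1 ≤ j) (h4 : j ≤ y.numLeaves) :
    graft (graft x i y) (i + j - 1) z = graft x i (graft y j z) := by
  induction x generalizing i with
  | nil =>
    have : i = 1 := le_antisymm h2 h1
    simp [graft, this]
  | node v l r hl hr =>
    simp only [numLeaves] at h2
    by_cases h : i ≤ l.numLeaves
    · have e := numLeaves_graft l i y h1 h
      have h' : i + j - 1 ≤ (graft l i y).numLeaves := by omega
      simp only [graft, if_pos h, if_pos h', hl i h1 h]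
    · have h' : ¬ i + j - 1 ≤ l.numLeaves := by omega
      have e : i + j - 1 - l.numLeaves = i - l.numLeaves + j - 1 := by omega
      simp only [graft, if_neg h, if_neg h', e]
      rw [hr (i - l.numLeaves) (by omega) (by omega)]

theorem graft_disjoint (x y z : BinaryTree Unit) (i j : ℕ) (h1 : 1 ≤ i) (h2 : i < j)
    (h3 : j ≤ x.numLeaves) :
    graft (graft x i y) (j + y.numLeaves - 1) z = graft (graft x j z) i y := by
  induction x generalizing i j with
  | nil =>
    simp only [numLeaves] at h3
    omega
  | node v l r hl hr =>
    have hy := y.numLeaves_pos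
    have hz := z.numLeaves_pos
    simp only [numLeaves] at h3
    by_cases hi : i ≤ l.numLeaves
    · have e := numLeaves_graft l i y h1 hi
      by_cases hj : j ≤ l.numLeaves
      · have e' := numLeaves_graft l j z (by omega) hj
        have hi' : i ≤ (graft l j z).numLeaves := by omega
        have hj' : j + y.numLeaves - 1 ≤ (graft l i y).numLeaves := by omega
        simp only [graft, if_pos hi, if_pos hj, if_pos hi', if_pos hj', hl i j h1 h2 hj]
      · have hj' : ¬ j + y.numLeaves - 1 ≤ (graft l i y).numLeaves := by omega
        have e' : j + y.numLeaves - 1 - (graft l i y).numLeaves = j - l.numLeaves := by omega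
        simp only [graft, if_pos hi, if_neg hj, if_neg hj', e']
    · have hj : ¬ j ≤ l.numLeaves := by omega
      have hj' : ¬ j + y.numLeaves - 1 ≤ l.numLeaves := by omega
      have e' : j + y.numLeaves - 1 - l.numLeaves = j - l.numLeaves + y.numLeaves - 1 := by omega
      simp only [graft, if_neg hi, if_neg hj, if_neg hj', e']
      rw [hr (i - l.numLeaves) (j - l.numLeaves) (by omega) (by omega) (by omega)]

theorem graft_nil (x : BinaryTree Unit) (i : ℕ) : graft x i nil = x := by
  induction x generalizing i with
  | nil => simp [graft]
  | node v l r hl hr => simp [graft, hl, hr]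

/-- The left comb of degree `d`. -/
def leftComb : ℕ → BinaryTree Unit
  | 0 => nil
  | d + 1 => node () (leftComb d) nil

/-- The right comb of degree `d`. -/
def rightComb : ℕ → BinaryTree Unit
  | 0 => nil
  | d + 1 => node () nil (rightComb d)

theorem numLeaves_leftComb (d : ℕ) : (leftComb d).numLeaves = d + 1 := by
  induction d with
  | zero => rfl
  | succ d ih => simp [leftComb, ih]

theorem numLeaves_rightComb (d : ℕ) : (rightComb d).numLeaves = d + 1 := by
  induction d with
  | zero => rfl
  | succ d ih => simp [rightComb, ih, Nat.add_comm]

end BinaryTree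

/-- The magmatic operad: all the binary trees, the arity of a tree being its number of leaves, the
partial compositions being the graftings, and the unit being the leaf. -/
def Mag : NSOperad.{0} where
  carrier := BinaryTree Unit
  arity := BinaryTree.numLeaves
  one_le_arity := BinaryTree.numLeaves_pos
  unit := BinaryTree.nil
  arity_unit := rfl
  comp := BinaryTree.graft
  arity_comp := BinaryTree.numLeaves_graft
  comp_nested := BinaryTree.graft_nested
  comp_disjoint := BinaryTree.graft_disjoint
  unit_comp := fun _ => rfl
  comp_unit := fun x i _ _ => BinaryTree.graft_nil x i

/-- The smallest operad congruence of `Mag` that identifies the left comb and the right comb of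
degree `γ`. -/
def combCongruence (γ : ℕ) : Mag.Congruence :=
  NSOperad.Congruence.generate Mag
    (fun s t => s = BinaryTree.leftComb γ ∧ t = BinaryTree.rightComb γ)
    (by
      rintro _ _ ⟨rfl, rfl⟩
      exact (BinaryTree.numLeaves_leftComb γ).trans (BinaryTree.numLeaves_rightComb γ).symm)

/-- The `γ`-comb associative operad. -/
noncomputable def CAs (γ : ℕ) : NSOperad.{0} := (combCongruence γ).quotient

/-!
The operad congruence that defines `CAs 3` is the congruence `CombRel` of the free magma on one
generator `x` that is generated by the identity `((a b) c) d = a (b (c d))`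
(`combCongruence_three_rel_iff`). So the classes of trees with `n` leaves have to be counted.

*Representatives.* The identity, read from left to right, completes to a system `rules` of eleven
rewrite rules, each of which is a consequence of the identity (`combRel_of_mem_rules`). A rule keeps
the number of leaves and makes the sequence of the sizes of the left subtrees along the right spine
lexicographically smaller (`spineCode_lt_of_mem_rules`), so that every tree is congruent to a normal
one, to which no rule applies (`exists_isNormal`).

*At most ten leaves.* There are finitely many normal trees, and they are listed by `normalTrees`.
They are pairwise incongruent: rewriting defines a product on the normal trees, which is found to
satisfy the identity as long as there are at most ten leaves (`normalMul_assoc`), and evaluation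
in this partial magma is an invariant of the congruence that fixes the normal trees
(`CombRel.eq_of_isNormal`).

*At least eleven leaves.* A normal tree is either rigid, which means that the identity cannot be
applied to any of its subtrees in either direction, or one of four trees similar to a right comb
(`rigid_or_eq_combTree`). A rigid tree is alone in its class. It consists of two zigzags below the
root, so there are `n - 1` rigid trees with `n` leaves. The other four trees are told apart
by the parities of the depths of the leftmost and of the rightmost leaf, which the identity
preserves (`eq_of_combRel_combTree`). This makes `n + 3` classes.
-/

namespace BinaryTree

/-! ### The comb identity as a magma congruence -/

/-- The smallest congruence of the free magma on one generator such that
`((a b) c) d = a (b (c d))` for all `a`, `b`, `c`, `d`. -/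
inductive CombRel : BinaryTree Unit → BinaryTree Unit → Prop
  | refl (t) : CombRel t t
  | symm {s t} : CombRel s t → CombRel t s
  | trans {s t u} : CombRel s t → CombRel t u → CombRel s u
  | node {l l' r r'} : CombRel l l' → CombRel r r' → CombRel (l △ r) (l' △ r')
  | assoc (a b c d) : CombRel (((a △ b) △ c) △ d) (a △ b △ c △ d)

namespace CombRel

theorem left {l l' : BinaryTree Unit} (h : CombRel l l') (r : BinaryTree Unit) :
    CombRel (l △ r) (l' △ r) :=
  h.node (refl r)

theorem right (l : BinaryTree Unit) {r r' : BinaryTree Unit} (h : CombRel r r') :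
    CombRel (l △ r) (l △ r') :=
  (refl l).node h

theorem numLeaves_eq {s t : BinaryTree Unit} (h : CombRel s t) : s.numLeaves = t.numLeaves := by
  induction h with
  | refl t => rfl
  | symm _ ih => exact ih.symm
  | trans _ _ ih ih' => exact ih.trans ih'
  | node _ _ ih ih' => simp [numLeaves, ih, ih']
  | assoc a b c d => simp only [numLeaves]; omega

theorem graft_left {s t : BinaryTree Unit} (h : CombRel s t) (i : ℕ) (u : BinaryTree Unit) :
    CombRel (graft s i u) (graft t i u) := by
  induction h generalizing i with
  | refl t => exact refl _
  | symm _ ih => exact (ih i).symm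
  | trans _ _ ih ih' => exact (ih i).trans (ih' i)
  | node h h' ih ih' =>
    simp only [graft, h.numLeaves_eq]
    split_ifs
    · exact (ih i).node h'
    · exact h.node (ih' _)
  | assoc a b c d =>
    by_cases ha : i ≤ a.numLeaves
    · have h1 : i ≤ a.numLeaves + b.numLeaves := by omega
      have h2 : i ≤ a.numLeaves + b.numLeaves + c.numLeaves := by omega
      simp only [graft, numLeaves, ha, h1, h2, if_true]
      exact assoc _ _ _ _
    by_cases hb : i ≤ a.numLeaves + b.numLeaves
    · have h1 : i - a.numLeaves ≤ b.numLeaves := by omega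
      have h2 : i ≤ a.numLeaves + b.numLeaves + c.numLeaves := by omega
      simp only [graft, numLeaves, ha, hb, h1, h2, if_true, if_false]
      exact assoc _ _ _ _
    have h1 : ¬ i - a.numLeaves ≤ b.numLeaves := by omega
    by_cases hc : i ≤ a.numLeaves + b.numLeaves + c.numLeaves
    · have h2 : i - a.numLeaves - b.numLeaves ≤ c.numLeaves := by omega
      have h3 : i - (a.numLeaves + b.numLeaves) = i - a.numLeaves - b.numLeaves := by omega
      simp only [graft, numLeaves, ha, hb, hc, h1, h2, h3, if_true, if_false]
      exact assoc _ _ _ _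
    · have h2 : ¬ i - a.numLeaves - b.numLeaves ≤ c.numLeaves := by omega
      have h3 : i - (a.numLeaves + b.numLeaves + c.numLeaves) =
        i - a.numLeaves - b.numLeaves - c.numLeaves := by omega
      simp only [graft, numLeaves, ha, hb, hc, h1, h2, h3, if_false]
      exact assoc _ _ _ _

theorem graft_right (t : BinaryTree Unit) (i : ℕ) {s s' : BinaryTree Unit} (h : CombRel s s') :
    CombRel (graft t i s) (graft t i s') := by
  induction t generalizing i with
  | nil =>
    simp only [graft]
    split_ifs
    exacts [h, refl _]
  | node _ l r ihl ihr =>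
    simp only [graft]
    split_ifs
    exacts [(ihl _).left _, (ihr _).right _]

end CombRel

/-- The operad congruence that defines `CAs 3` is the magma congruence `CombRel`: substituting
trees for the leaves of the two combs turns one identification into the identity
`((a b) c) d = a (b (c d))`. -/
theorem combCongruence_three_rel_iff {s t : BinaryTree Unit} :
    (combCongruence 3).rel s t ↔ CombRel s t := by
  constructor
  · intro h
    refine h ⟨CombRel, ⟨.refl, .symm, .trans⟩, CombRel.numLeaves_eq, ?_⟩ ?_
    · intro x x' y y' i _ _ hx hy
      exact (hx.graft_left i y).trans (CombRel.graft_right x' i hy)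
    · rintro _ _ ⟨rfl, rfl⟩
      exact CombRel.assoc nil nil nil nil
  · intro h
    have eqv := (combCongruence 3).equivalence
    have comp : ∀ {x x' y y' : BinaryTree Unit} (i : ℕ), 1 ≤ i → i ≤ x.numLeaves →
        (combCongruence 3).rel x x' → (combCongruence 3).rel y y' →
        (combCongruence 3).rel (graft x i y) (graft x' i y') :=
      fun i h1 h2 hx hy => (combCongruence 3).comp_rel i h1 h2 hx hy
    induction h with
    | refl t => exact eqv.refl t
    | symm _ ih => exact eqv.symm ih
    | trans _ _ ih ih' => exact eqv.trans ih ih'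
    | @node l l' r r' _ _ ih ih' =>
      have h := comp 1 le_rfl (by simp [graft])
        (comp 2 (by simp) (by simp) (eqv.refl (nil △ nil)) ih') ih
      simpa [graft] using h
    | assoc a b c d =>
      have h : (combCongruence 3).rel (leftComb 3) (rightComb 3) :=
        NSOperad.Congruence.generate_of ⟨rfl, rfl⟩
      have h := comp 4 (by simp) (by simp [leftComb]) h (eqv.refl d)
      have h := comp 3 (by simp) (by simp [leftComb, graft]) h (eqv.refl c)
      have h := comp 2 (by simp) (by simp [leftComb, graft, Nat.add_assoc]) h (eqv.refl b)
      have h := comp 1 (by simp) (by simp [leftComb, graft, Nat.add_assoc]) h (eqv.refl a)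
      simpa [leftComb, rightComb, graft, Nat.add_assoc] using h

/-! ### Invariants of the congruence -/

/-- The number of edges on the path from the root to the leftmost leaf. -/
def leftDepth : BinaryTree Unit → ℕ
  | nil => 0
  | node _ l _ => leftDepth l + 1

/-- The number of edges on the path from the root to the rightmost leaf. -/
def rightDepth : BinaryTree Unit → ℕ
  | nil => 0
  | node _ _ r => rightDepth r + 1

/-- A tree is rigid if none of its subtrees has the form `((a b) c) d` or `a (b (c d))`, so that
the comb identity does not apply to it anywhere. -/
def rigid : BinaryTree Unit → Bool
  | nil => true
  | node _ l r => rigid l && rigid r && decide (l.left = nil) && decide (r.right = nil)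

namespace CombRel

theorem leftDepth_mod_two {s t : BinaryTree Unit} (h : CombRel s t) :
    leftDepth s % 2 = leftDepth t % 2 := by
  induction h with
  | refl t => rfl
  | symm _ ih => exact ih.symm
  | trans _ _ ih ih' => exact ih.trans ih'
  | node _ _ ih _ => simp only [leftDepth]; omega
  | assoc a b c d => simp only [leftDepth]; omega

theorem rightDepth_mod_two {s t : BinaryTree Unit} (h : CombRel s t) :
    rightDepth s % 2 = rightDepth t % 2 := by
  induction h with
  | refl t => rfl
  | symm _ ih => exact ih.symm
  | trans _ _ ih ih' => exact ih.trans ih'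
  | node _ _ _ ih => simp only [rightDepth]; omega
  | assoc a b c d => simp only [rightDepth]; omega

theorem eq_or_not_rigid {s t : BinaryTree Unit} (h : CombRel s t) :
    s = t ∨ rigid s = false ∧ rigid t = false := by
  induction h with
  | refl t => exact .inl rfl
  | symm _ ih => exact ih.imp Eq.symm And.symm
  | trans _ _ ih ih' =>
    rcases ih with rfl | ih
    · exact ih'
    · rcases ih' with rfl | ih'
      exacts [.inr ih, .inr ⟨ih.1, ih'.2⟩]
  | node _ _ ih ih' =>
    rcases ih with rfl | ih
    · rcases ih' with rfl | ih'
      · exact .inl rfl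
      · simp [rigid, ih']
    · simp [rigid, ih]
  | assoc a b c d => simp [rigid]

/-- A rigid tree is alone in its class. -/
theorem eq_of_rigid {s t : BinaryTree Unit} (h : CombRel s t) (hs : rigid s = true) : s = t :=
  h.eq_or_not_rigid.resolve_right fun h' => by simp [hs] at h'

end CombRel

/-- The zigzag with `n` internal nodes, each of which has a leaf as one of its children: the left
child of the root is a leaf if `b` is true, the right child if `b` is false, and the sides alternate
along the path of internal nodes. -/
def zigzag : Bool → ℕ → BinaryTree Unit
  | _, 0 => nil
  | true, n + 1 => nil △ zigzag false n
  | false, n + 1 => zigzag true n △ nil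

theorem numLeaves_zigzag (b : Bool) (n : ℕ) : (zigzag b n).numLeaves = n + 1 := by
  induction n generalizing b with
  | zero => cases b <;> rfl
  | succ n ih => cases b <;> simp [zigzag, ih, Nat.add_comm]

theorem rigid_zigzag (b : Bool) (n : ℕ) : rigid (zigzag b n) = true ∧
    if b then (zigzag b n).left = nil else (zigzag b n).right = nil := by
  induction n generalizing b with
  | zero => cases b <;> simp [zigzag, rigid]
  | succ n ih =>
    have h1 := ih true
    have h2 := ih false
    cases b <;> simp_all [zigzag, rigid]

theorem rigid_zigzag_node_zigzag (i j : ℕ) :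
    rigid (zigzag true i △ zigzag false j) = true := by
  have h1 := rigid_zigzag true i
  have h2 := rigid_zigzag false j
  simp_all [rigid]

theorem eq_zigzag_of_rigid {t : BinaryTree Unit} (ht : rigid t = true) :
    (t.left = nil → ∃ n, t = zigzag true n) ∧ (t.right = nil → ∃ n, t = zigzag false n) := by
  induction t using unitRecOn with
  | base => exact ⟨fun _ => ⟨0, rfl⟩, fun _ => ⟨0, rfl⟩⟩
  | ind l r ihl ihr =>
    simp only [rigid, Bool.and_eq_true, decide_eq_true_eq] at ht
    obtain ⟨⟨⟨hl, hr⟩, hll⟩, hrr⟩ := ht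
    constructor
    · rintro (rfl : l = nil)
      obtain ⟨n, rfl⟩ := (ihr hr).2 hrr
      exact ⟨n + 1, rfl⟩
    · rintro (rfl : r = nil)
      obtain ⟨n, rfl⟩ := (ihl hl).1 hll
      exact ⟨n + 1, rfl⟩

/-- The rigid trees are the trees with two zigzags grafted at the root, which turn back towards
the inside at every step. -/
theorem exists_zigzag_of_rigid_node {l r : BinaryTree Unit} (h : rigid (l △ r) = true) :
    ∃ i j, l = zigzag true i ∧ r = zigzag false j := by
  simp only [rigid, Bool.and_eq_true, decide_eq_true_eq] at h
  obtain ⟨⟨⟨hl, hr⟩, hll⟩, hrr⟩ := h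
  obtain ⟨i, hi⟩ := (eq_zigzag_of_rigid hl).1 hll
  obtain ⟨j, hj⟩ := (eq_zigzag_of_rigid hr).2 hrr
  exact ⟨i, j, hi, hj⟩

/-! ### A terminating rewriting system for the congruence -/

namespace CombRel

/-! `ruleₙ` is the `n`-th rule of the list `rules` below; the first one is `CombRel.assoc`. Each of
them follows from the previous ones, used in both directions. -/

variable (a b c d e f g h : BinaryTree Unit)

theorem rule₂ : CombRel ((a △ b △ c △ d) △ e) ((a △ b) △ c △ d △ e) :=
  ((assoc a b c d).symm.left e).trans (assoc (a △ b) c d e)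

theorem rule₃ : CombRel (a △ b △ (c △ d △ e) △ f) (a △ b △ c △ d △ e △ f) :=
  (assoc a b (c △ d △ e) f).symm.trans <|
    (rule₂ (a △ b) c d e f).trans (assoc a b c (d △ e △ f))

theorem rule₄ : CombRel (a △ (b △ c △ d) △ e △ f) (a △ b △ c △ d △ e △ f) :=
  (assoc a (b △ c △ d) e f).symm.trans <| ((rule₂ a b c d e).left f).trans <|
    (assoc a b (c △ d △ e) f).trans (rule₃ a b c d e f)

theorem rule₅ : CombRel (a △ b △ (c △ d) △ e △ f △ g) (a △ b △ c △ d △ (e △ f) △ g) :=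
  (rule₃ a b (c △ d) e f g).symm.trans (((assoc c d (e △ f) g).right b).right a)

theorem rule₆ : CombRel (a △ (b △ c) △ d △ e △ f △ g) (a △ b △ c △ (d △ e) △ f △ g) :=
  (rule₄ a (b △ c) d e f g).symm.trans ((assoc b c (d △ e) (f △ g)).right a)

theorem rule₇ : CombRel ((a △ (b △ c) △ d) △ e △ f △ g) ((a △ b) △ c △ d △ e △ f △ g) :=
  (rule₂ a ((b △ c) △ d) e f g).symm.trans <|
    (((assoc b c d (e △ f)).right a).left g).trans <|
      (rule₂ a b c (d △ e △ f) g).trans (rule₃ (a △ b) c d e f g)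

theorem rule₈ :
    CombRel (a △ b △ c △ d △ (e △ f) △ g △ h) (a △ b △ c △ d △ e △ (f △ g) △ h) :=
  (rule₅ a b c d e f (g △ h)).symm.trans <| (rule₄ a b (c △ d) e f (g △ h)).symm.trans <|
    ((rule₇ b c d e f g h).right a).trans <| (rule₆ a b c d e f (g △ h)).trans <|
      (rule₅ b c d e f g h).right a

theorem rule₉ :
    CombRel (a △ b △ c △ (d △ e) △ (f △ g) △ h) (a △ b △ c △ d △ e △ f △ g △ h) :=
  (rule₅ a b c (d △ e) f g h).symm.trans (rule₃ a b c d e (f △ g △ h))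

theorem rule₁₀ :
    CombRel ((a △ b) △ c △ d △ (e △ f) △ g △ h) ((a △ b) △ c △ d △ e △ (f △ g) △ h) :=
  (((assoc d (e △ f) g h).symm.right c).right (a △ b)).trans <|
    (rule₂ a b c ((d △ e △ f) △ g) h).symm.trans <| (((rule₃ b c d e f g).right a).left h).trans <|
      (rule₂ a b c (d △ e △ f △ g) h).trans (rule₃ (a △ b) c d e (f △ g) h)

theorem rule₁₁ :
    CombRel ((a △ b △ c) △ d △ e △ f △ g △ h) ((a △ b) △ c △ d △ e △ (f △ g) △ h) :=
  (rule₂ a (b △ c) d e (f △ g △ h)).symm.trans <| (rule₇ a b c (d △ e) f g h).trans <|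
    rule₅ (a △ b) c d e f g h

end CombRel

/-- The tree obtained from `p` by replacing its leaves, from left to right, by `σ 0`, `σ 1`, … -/
def subst : BinaryTree Unit → (ℕ → BinaryTree Unit) → BinaryTree Unit
  | nil, σ => σ 0
  | node _ l r, σ => subst l σ △ subst r fun i => σ (l.numLeaves + i)

/-- Whether a tree is an instance `subst p σ` of the pattern `p`. -/
def isInstance : BinaryTree Unit → BinaryTree Unit → Bool
  | nil, _ => true
  | node _ _ _, nil => false
  | node _ p q, node _ l r => isInstance p l && isInstance q r

/-- The subtrees of an instance of the pattern `p` that stand at the leaves of `p`. -/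
def leafSubtrees : BinaryTree Unit → BinaryTree Unit → List (BinaryTree Unit)
  | nil, t => [t]
  | node _ _ _, nil => []
  | node _ p q, node _ l r => leafSubtrees p l ++ leafSubtrees q r

theorem length_leafSubtrees {p t : BinaryTree Unit} (h : isInstance p t = true) :
    (leafSubtrees p t).length = p.numLeaves := by
  induction p generalizing t with
  | nil => rfl
  | node _ p q ihp ihq =>
    cases t with
    | nil => simp [isInstance] at h
    | node _ l r =>
      simp only [isInstance, Bool.and_eq_true] at h
      simp [leafSubtrees, ihp h.1, ihq h.2]

theorem subst_congr {p : BinaryTree Unit} {σ τ : ℕ → BinaryTree Unit}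
    (h : ∀ i < p.numLeaves, σ i = τ i) : subst p σ = subst p τ := by
  induction p generalizing σ τ with
  | nil => exact h 0 (by simp)
  | node _ p q ihp ihq =>
    simp only [numLeaves] at h
    simp only [subst]
    rw [ihp fun i hi => h i (by omega), ihq fun i hi => h _ (by omega)]

theorem subst_leafSubtrees {p t : BinaryTree Unit} (h : isInstance p t = true) :
    subst p (fun i => (leafSubtrees p t).getD i nil) = t := by
  induction p generalizing t with
  | nil => rfl
  | node _ p q ihp ihq =>
    cases t with
    | nil => simp [isInstance] at h
    | node _ l r =>
      simp only [isInstance, Bool.and_eq_true] at h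
      have hlen := length_leafSubtrees h.1
      simp only [subst, leafSubtrees]
      congr 1
      · refine Eq.trans (subst_congr fun i hi => ?_) (ihp h.1)
        rw [List.getD_append _ _ _ _ (by omega)]
      · refine Eq.trans (subst_congr fun i _ => ?_) (ihq h.2)
        rw [List.getD_append_right _ _ _ _ (by omega), hlen, Nat.add_sub_cancel_left]

theorem numLeaves_subst (p : BinaryTree Unit) (σ : ℕ → BinaryTree Unit) :
    (subst p σ).numLeaves = ∑ i ∈ Finset.range p.numLeaves, (σ i).numLeaves := by
  induction p generalizing σ with
  | nil => simp [subst]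
  | node _ p q ihp ihq => simp [subst, ihp, ihq, Finset.sum_range_add]

/-- The rewrite rules: pairs of patterns with the same number of leaves. They are the comb identity,
read from left to right, and consequences of it that are added to make normal forms unique, each
oriented so that `spineCode` increases. -/
def rules : List (BinaryTree Unit × BinaryTree Unit) :=
  let x : BinaryTree Unit := nil
  [(((x △ x) △ x) △ x, x △ x △ x △ x),
    ((x △ x △ x △ x) △ x, (x △ x) △ x △ x △ x),
    (x △ x △ (x △ x △ x) △ x, x △ x △ x △ x △ x △ x),
    (x △ (x △ x △ x) △ x △ x, x △ x △ x △ x △ x △ x),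
    (x △ x △ (x △ x) △ x △ x △ x, x △ x △ x △ x △ (x △ x) △ x),
    (x △ (x △ x) △ x △ x △ x △ x, x △ x △ x △ (x △ x) △ x △ x),
    ((x △ (x △ x) △ x) △ x △ x △ x, (x △ x) △ x △ x △ x △ x △ x),
    (x △ x △ x △ x △ (x △ x) △ x △ x, x △ x △ x △ x △ x △ (x △ x) △ x),
    (x △ x △ x △ (x △ x) △ (x △ x) △ x, x △ x △ x △ x △ x △ x △ x △ x),
    ((x △ x) △ x △ x △ (x △ x) △ x △ x, (x △ x) △ x △ x △ x △ (x △ x) △ x),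
    ((x △ x △ x) △ x △ x △ x △ x △ x, (x △ x) △ x △ x △ x △ (x △ x) △ x)]

theorem combRel_of_mem_rules {p q : BinaryTree Unit} (h : (p, q) ∈ rules)
    (σ : ℕ → BinaryTree Unit) : CombRel (subst p σ) (subst q σ) := by
  simp only [rules, List.mem_cons, Prod.mk.injEq, List.not_mem_nil, or_false] at h
  rcases h with h | h | h | h | h | h | h | h | h | h | h <;> obtain ⟨rfl, rfl⟩ := h
  exacts [.assoc _ _ _ _, .rule₂ _ _ _ _ _, .rule₃ _ _ _ _ _ _, .rule₄ _ _ _ _ _ _,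
    .rule₅ _ _ _ _ _ _ _, .rule₆ _ _ _ _ _ _ _, .rule₇ _ _ _ _ _ _ _, .rule₈ _ _ _ _ _ _ _ _,
    .rule₉ _ _ _ _ _ _ _ _, .rule₁₀ _ _ _ _ _ _ _ _, .rule₁₁ _ _ _ _ _ _ _ _]

/-- The numbers of leaves of the successive right subtrees along the right spine of a tree, encoded
as the binary digits of a number. Among the trees with a given number of leaves, `spineCode` is
larger if the sequence of the sizes of the left subtrees along the right spine is
lexicographically smaller. -/
def spineCode : BinaryTree Unit → ℕ
  | nil => 0
  | node _ _ r => 2 ^ r.numLeaves + spineCode r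

theorem spineCode_lt (t : BinaryTree Unit) : spineCode t < 2 ^ t.numLeaves := by
  induction t with
  | nil => simp [spineCode]
  | node _ l r _ ih =>
    have h : 2 ^ (r.numLeaves + 1) ≤ 2 ^ (l.numLeaves + r.numLeaves) :=
      Nat.pow_le_pow_right (by simp) (by have := l.numLeaves_pos; omega)
    rw [pow_succ] at h
    simp only [spineCode, numLeaves]
    omega

/-- Whether the sequence of the sizes of the left subtrees along the right spine is
lexicographically smaller for the pattern `q` than for the pattern `p`. -/
def spineDecreases : BinaryTree Unit → BinaryTree Unit → Bool
  | node _ l r, node _ l' r' => decide (l'.numLeaves < l.numLeaves) ||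
      decide (l'.numLeaves = l.numLeaves) && spineDecreases r r'
  | _, _ => false

theorem spineCode_subst_lt {p q : BinaryTree Unit} (h : spineDecreases p q = true)
    (hpq : p.numLeaves = q.numLeaves) (σ : ℕ → BinaryTree Unit) :
    spineCode (subst p σ) < spineCode (subst q σ) := by
  induction p generalizing q σ with
  | nil => simp [spineDecreases] at h
  | node _ l r _ ih =>
    cases q with
    | nil => simp [spineDecreases] at h
    | node _ l' r' =>
      have hsize := (numLeaves_subst (node () l r) σ).trans
        (hpq ▸ (numLeaves_subst (node () l' r') σ).symm)
      simp only [subst, numLeaves] at hsize hpq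
      simp only [spineDecreases, Bool.or_eq_true, Bool.and_eq_true, decide_eq_true_eq] at h
      simp only [subst, spineCode]
      rcases h with h | ⟨h, h'⟩
      · -- The left subtree loses leaves to the right one, so a larger power of two leads the code.
        have hl : (subst l' σ).numLeaves < (subst l σ).numLeaves := by
          rw [numLeaves_subst, numLeaves_subst]
          exact Finset.sum_lt_sum_of_subset (Finset.range_mono h.le) (i := l'.numLeaves)
            (by simpa using h) (by simp) (numLeaves_pos _) fun _ _ _ => Nat.zero_le _
        have hr := spineCode_lt (subst r fun i => σ (l.numLeaves + i))
        have hpow := Nat.pow_le_pow_right (n := 2) (by simp)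
          (show (subst r fun i => σ (l.numLeaves + i)).numLeaves + 1 ≤
            (subst r' fun i => σ (l'.numLeaves + i)).numLeaves by omega)
        rw [pow_succ] at hpow
        omega
      · have hl : (subst l' σ).numLeaves = (subst l σ).numLeaves := by
          rw [numLeaves_subst, numLeaves_subst, h]
        have hr := ih h' (by omega) fun i => σ (l.numLeaves + i)
        rw [h] at hsize ⊢
        have : (subst r fun i => σ (l.numLeaves + i)).numLeaves =
          (subst r' fun i => σ (l.numLeaves + i)).numLeaves := by omega
        rw [this]
        omega

theorem spineCode_lt_of_mem_rules {p q : BinaryTree Unit} (h : (p, q) ∈ rules)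
    (σ : ℕ → BinaryTree Unit) : spineCode (subst p σ) < spineCode (subst q σ) := by
  have hall : ∀ pq ∈ rules, spineDecreases pq.1 pq.2 = true ∧
    pq.1.numLeaves = pq.2.numLeaves := by decide
  exact spineCode_subst_lt (hall _ h).1 (hall _ h).2 σ

/-- The result of applying the first applicable rewrite rule at the root, if there is one. -/
def rootStep (t : BinaryTree Unit) : Option (BinaryTree Unit) :=
  (rules.find? fun pq => isInstance pq.1 t).map fun pq =>
    subst pq.2 fun i => (leafSubtrees pq.1 t).getD i nil

theorem exists_rule_of_rootStep {t t' : BinaryTree Unit} (h : rootStep t = some t') :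
    ∃ p q σ, (p, q) ∈ rules ∧ t = subst p σ ∧ t' = subst q σ := by
  simp only [rootStep, Option.map_eq_some_iff, Prod.exists] at h
  obtain ⟨p, q, h, rfl⟩ := h
  have hi : isInstance p t = true := by simpa using List.find?_some h
  exact ⟨p, q, _, List.mem_of_find?_eq_some h, (subst_leafSubtrees hi).symm, rfl⟩

theorem combRel_of_rootStep {t t' : BinaryTree Unit} (h : rootStep t = some t') :
    CombRel t t' := by
  obtain ⟨p, q, σ, hpq, rfl, rfl⟩ := exists_rule_of_rootStep h
  exact combRel_of_mem_rules hpq σ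

theorem spineCode_lt_of_rootStep {t t' : BinaryTree Unit} (h : rootStep t = some t') :
    spineCode t < spineCode t' := by
  obtain ⟨p, q, σ, hpq, rfl, rfl⟩ := exists_rule_of_rootStep h
  exact spineCode_lt_of_mem_rules hpq σ

/-- Whether no rewrite rule applies to a tree at any of its nodes. -/
def isNormal : BinaryTree Unit → Bool
  | nil => true
  | node _ l r => isNormal l && isNormal r && (rootStep (l △ r)).isNone

/-- Every tree can be rewritten to a normal one. The inequality makes the induction work: when the
right subtree is replaced by a normal one, the code of the whole tree must not drop. -/
theorem exists_isNormal (t : BinaryTree Unit) :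
    ∃ s, isNormal s = true ∧ CombRel t s ∧ spineCode t ≤ spineCode s := by
  cases t with
  | nil => exact ⟨nil, rfl, .refl _, le_rfl⟩
  | node _ l r =>
    have hl := l.numLeaves_pos
    have hr := r.numLeaves_pos
    obtain ⟨l', hl', hll', -⟩ := exists_isNormal l
    obtain ⟨r', hr', hrr', hle⟩ := exists_isNormal r
    have hrel := hll'.node hrr'
    have hcode : spineCode (node () l r) ≤ spineCode (l' △ r') := by
      simp only [spineCode, hrr'.numLeaves_eq]
      omega
    cases hstep : rootStep (l' △ r') with
    | none => exact ⟨l' △ r', by simp [isNormal, hl', hr', hstep], hrel, hcode⟩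
    | some t' =>
      have hrel' := hrel.trans (combRel_of_rootStep hstep)
      have hlt := hcode.trans_lt (spineCode_lt_of_rootStep hstep)
      have hbound := spineCode_lt t'
      have hsize := hrel'.numLeaves_eq
      obtain ⟨s, hs, hts, hle'⟩ := exists_isNormal t'
      exact ⟨s, hs, hrel'.trans hts, hlt.le.trans hle'⟩
termination_by (t.numLeaves, 2 ^ t.numLeaves - spineCode t)
decreasing_by
  · exact Prod.Lex.left _ _ (by simp only [numLeaves]; omega)
  · exact Prod.Lex.left _ _ (by simp only [numLeaves]; omega)
  · rw [← hsize] at hbound ⊢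
    exact Prod.Lex.right _ (show 2 ^ (l △ r).numLeaves - spineCode t' <
      2 ^ (l △ r).numLeaves - spineCode (l △ r) by omega)

/-! ### Normal trees with at most ten leaves -/

/-- The lists of the normal trees with `n + 1`, `n`, …, `1` leaves, in this order. -/
def normalLists : ℕ → List (List (BinaryTree Unit))
  | 0 => [[nil]]
  | n + 1 =>
    (((normalLists n).zip (normalLists n).reverse).flatMap fun p =>
      p.1.flatMap fun l => (p.2.filter fun r => (rootStep (l △ r)).isNone).map fun r => l △ r) ::
      normalLists n

theorem length_normalLists (n : ℕ) : (normalLists n).length = n + 1 := by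
  induction n with
  | zero => rfl
  | succ n ih => simp [normalLists, ih]

theorem mem_getD_normalLists {t : BinaryTree Unit} (ht : isNormal t = true) {n k : ℕ}
    (hk : k ≤ n) (htk : t.numLeaves = k + 1) : t ∈ (normalLists n).getD (n - k) [] := by
  induction n generalizing t k with
  | zero =>
    cases t with
    | nil => obtain rfl : k = 0 := by omega
             simp [normalLists]
    | node _ l r =>
      have := l.numLeaves_pos
      have := r.numLeaves_pos
      simp only [numLeaves] at htk
      omega
  | succ n ih =>
    rcases Nat.lt_or_ge n k with h | h
    · obtain rfl : k = n + 1 := by omega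
      cases t with
      | nil => simp at htk
      | node _ l r =>
        obtain ⟨a, ha⟩ := Nat.exists_eq_add_of_le' l.numLeaves_pos
        obtain ⟨b, hb⟩ := Nat.exists_eq_add_of_le' r.numLeaves_pos
        simp only [numLeaves] at htk
        simp only [isNormal, Bool.and_eq_true] at ht
        have hl := ih ht.1.1 (k := a) (by omega) ha
        have hr := ih ht.1.2 (k := b) (by omega) hb
        have hlen := length_normalLists n
        rw [List.getD_eq_getElem _ _ (by omega)] at hl hr
        rw [Nat.sub_self]
        simp only [normalLists, List.getD_cons_zero, List.mem_flatMap, List.mem_map,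
          List.mem_filter]
        refine ⟨((normalLists n)[n - a], (normalLists n)[n - b]), ?_, l, hl, r, ⟨hr, ht.2⟩, rfl⟩
        refine List.mem_iff_getElem.2 ⟨n - a, by simp; omega, ?_⟩
        rw [List.getElem_zip, List.getElem_reverse]
        congr 2
        omega
    · rw [show n + 1 - k = n - k + 1 by omega, normalLists, List.getD_cons_succ]
      exact ih ht h htk

theorem mem_getD_reverse_normalLists {t : BinaryTree Unit} (ht : isNormal t = true) {n i : ℕ}
    (hi : i ≤ n) (hti : t.numLeaves = i + 1) : t ∈ (normalLists n).reverse.getD i [] := by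
  have hlen := length_normalLists n
  rw [List.getD_reverse _ (by omega), show (normalLists n).length - 1 - i = n - i by omega]
  exact mem_getD_normalLists ht hi hti

/-- The list of the normal trees with `n + 1` leaves. -/
def normalTrees (n : ℕ) : List (BinaryTree Unit) := (normalLists n).headD []

theorem mem_normalTrees {t : BinaryTree Unit} (ht : isNormal t = true) {n : ℕ}
    (htn : t.numLeaves = n + 1) : t ∈ normalTrees n := by
  have h := mem_getD_normalLists ht le_rfl htn
  rw [normalTrees]
  cases hL : normalLists n <;> simp_all

/-- The value of `k` at `t`. Reduction of this term evaluates `t` completely before it is passed to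
`k`, which keeps the computations below from evaluating the same tree again and again. -/
def force {β : Type} : BinaryTree Unit → (BinaryTree Unit → β) → β
  | nil, k => k nil
  | node _ l r, k => force l fun l' => force r fun r' => k (l' △ r')

theorem force_eq {β : Type} (t : BinaryTree Unit) (k : BinaryTree Unit → β) :
    force t k = k t := by
  induction t generalizing k with
  | nil => rfl
  | node _ l r ihl ihr => rw [force, ihl, ihr]

/-- The analogue of `force` for a list of trees. -/
def forceList {β : Type} : List (BinaryTree Unit) → (List (BinaryTree Unit) → β) → β
  | [], k => k []
  | t :: ts, k => force t fun t' => forceList ts fun ts' => k (t' :: ts')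

theorem forceList_eq {β : Type} (L : List (BinaryTree Unit)) (k : List (BinaryTree Unit) → β) :
    forceList L k = k L := by
  induction L generalizing k with
  | nil => rfl
  | cons t ts ih => rw [forceList, force_eq, ih]

/-- The analogue of `force` for a list of lists of trees. -/
def forceLists {β : Type} :
    List (List (BinaryTree Unit)) → (List (List (BinaryTree Unit)) → β) → β
  | [], k => k []
  | L :: Ls, k => forceList L fun L' => forceLists Ls fun Ls' => k (L' :: Ls')

theorem forceLists_eq {β : Type} (Ls : List (List (BinaryTree Unit)))
    (k : List (List (BinaryTree Unit)) → β) : forceLists Ls k = k Ls := by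
  induction Ls generalizing k with
  | nil => rfl
  | cons L Ls ih => rw [forceLists, forceList_eq, ih]

/-- The product of the family `σ` over the leaves of the tree `p`, with the bracketing given by `p`
and the binary operation `mul`. -/
def prodWith (mul : BinaryTree Unit → BinaryTree Unit → BinaryTree Unit) :
    BinaryTree Unit → (ℕ → BinaryTree Unit) → BinaryTree Unit
  | nil, σ => σ 0
  | node _ l r, σ =>
    force (prodWith mul l σ) fun l' =>
      force (prodWith mul r fun i => σ (l.numLeaves + i)) fun r' => mul l' r'

/-- The product of two normal trees, brought to normal form by rewriting; `k` bounds the depth of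
the recursion, which is stopped without reaching a normal form if `k` is too small. -/
def normalMul : ℕ → BinaryTree Unit → BinaryTree Unit → BinaryTree Unit
  | 0, l, r => l △ r
  | k + 1, l, r => (rules.find? fun pq => isInstance pq.1 (l △ r)).elim (l △ r) fun pq =>
    prodWith (normalMul k) pq.2 fun i => (leafSubtrees pq.1 (l △ r)).getD i nil

theorem combRel_prodWith {mul : BinaryTree Unit → BinaryTree Unit → BinaryTree Unit}
    (h : ∀ l r, CombRel (l △ r) (mul l r)) (p : BinaryTree Unit) (σ : ℕ → BinaryTree Unit) :
    CombRel (subst p σ) (prodWith mul p σ) := by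
  induction p generalizing σ with
  | nil => exact .refl _
  | node _ l r ihl ihr =>
    simp only [subst, prodWith, force_eq]
    exact ((ihl _).node (ihr _)).trans (h _ _)

theorem combRel_normalMul (k : ℕ) (l r : BinaryTree Unit) :
    CombRel (l △ r) (normalMul k l r) := by
  induction k generalizing l r with
  | zero => exact .refl _
  | succ k ih =>
    rw [normalMul]
    cases h : rules.find? fun pq => isInstance pq.1 (l △ r) with
    | none => exact .refl _
    | some pq =>
      exact (combRel_of_rootStep (by rw [rootStep, h]; rfl)).trans (combRel_prodWith ih _ _)

/-- The normal form of a tree with at most ten leaves: the image of the tree under the morphism of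
magmas to the normal trees with the product `normalMul`. -/
def normalForm : BinaryTree Unit → BinaryTree Unit
  | nil => nil
  | node _ l r => normalMul 10 (normalForm l) (normalForm r)

theorem combRel_normalForm (t : BinaryTree Unit) : CombRel t (normalForm t) := by
  induction t with
  | nil => exact .refl _
  | node _ l r ihl ihr => exact (ihl.node ihr).trans (combRel_normalMul 10 _ _)

theorem normalForm_eq_self {t : BinaryTree Unit} (ht : isNormal t = true) : normalForm t = t := by
  induction t with
  | nil => rfl
  | node _ l r ihl ihr =>
    simp only [isNormal, Bool.and_eq_true, Option.isNone_iff_eq_none] at ht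
    obtain ⟨⟨hl, hr⟩, h⟩ := ht
    rw [rootStep, Option.map_eq_none_iff] at h
    rw [normalForm, ihl hl, ihr hr, normalMul, h]
    rfl

/-- The computation that all products of two normal trees, with at most ten leaves in total, are
normal. -/
def normalMulIsNormalCheck : Bool :=
  forceLists (normalLists 8).reverse fun N =>
    (List.range 9).all fun i => (N.getD i []).all fun a =>
    (List.range (9 - i)).all fun j => (N.getD j []).all fun b =>
      force (normalMul 10 a b) isNormal

/-- The computation that the product of normal trees satisfies the comb identity, as long as there
are at most ten leaves in total. Two trees are compared by testing whether each is an instance of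
the other one. -/
def normalMulAssocCheck : Bool :=
  forceLists (normalLists 6).reverse fun N =>
    (List.range 7).all fun i => (N.getD i []).all fun a =>
    (List.range (7 - i)).all fun j => (N.getD j []).all fun b =>
    force (normalMul 10 a b) fun ab =>
    (List.range (7 - i - j)).all fun k => (N.getD k []).all fun c =>
    force (normalMul 10 ab c) fun abc =>
    (List.range (7 - i - j - k)).all fun l => (N.getD l []).all fun d =>
    force (normalMul 10 c d) fun cd =>
    force (normalMul 10 b cd) fun bcd =>
    force (normalMul 10 abc d) fun s =>
    force (normalMul 10 a bcd) fun t =>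
      isInstance s t && isInstance t s

set_option maxRecDepth 100000 in
theorem normalMulIsNormalCheck_eq_true : normalMulIsNormalCheck = true := by
  decide +kernel

set_option maxRecDepth 100000 in
theorem normalMulAssocCheck_eq_true : normalMulAssocCheck = true := by
  decide +kernel

theorem eq_of_isInstance {s t : BinaryTree Unit} (h : isInstance s t = true)
    (h' : isInstance t s = true) : s = t := by
  induction s generalizing t with
  | nil =>
    cases t with
    | nil => rfl
    | node _ _ _ => simp [isInstance] at h'
  | node _ l r ihl ihr =>
    cases t with
    | nil => simp [isInstance] at h
    | node _ l' r' =>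
      simp only [isInstance, Bool.and_eq_true] at h h'
      rw [ihl h.1 h'.1, ihr h.2 h'.2]

theorem isNormal_normalMul {a b : BinaryTree Unit} (ha : isNormal a = true)
    (hb : isNormal b = true) (hab : a.numLeaves + b.numLeaves ≤ 10) :
    isNormal (normalMul 10 a b) = true := by
  have h := normalMulIsNormalCheck_eq_true
  simp only [normalMulIsNormalCheck, forceLists_eq, force_eq, List.all_eq_true,
    List.mem_range] at h
  obtain ⟨i, hi⟩ := Nat.exists_eq_add_of_le' a.numLeaves_pos
  obtain ⟨j, hj⟩ := Nat.exists_eq_add_of_le' b.numLeaves_pos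
  exact h i (by omega) a (mem_getD_reverse_normalLists ha (by omega) hi)
    j (by omega) b (mem_getD_reverse_normalLists hb (by omega) hj)

/-- The comb identity for the product of normal trees. This replaces the analysis of the critical
pairs of the rewriting system, as far as trees with at most ten leaves are concerned. -/
theorem normalMul_assoc {a b c d : BinaryTree Unit} (ha : isNormal a = true)
    (hb : isNormal b = true) (hc : isNormal c = true) (hd : isNormal d = true)
    (hsize : a.numLeaves + b.numLeaves + c.numLeaves + d.numLeaves ≤ 10) :
    normalMul 10 (normalMul 10 (normalMul 10 a b) c) d =
      normalMul 10 a (normalMul 10 b (normalMul 10 c d)) := by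
  have h := normalMulAssocCheck_eq_true
  simp only [normalMulAssocCheck, forceLists_eq, force_eq, List.all_eq_true,
    List.mem_range, Bool.and_eq_true] at h
  obtain ⟨i, hi⟩ := Nat.exists_eq_add_of_le' a.numLeaves_pos
  obtain ⟨j, hj⟩ := Nat.exists_eq_add_of_le' b.numLeaves_pos
  obtain ⟨k, hk⟩ := Nat.exists_eq_add_of_le' c.numLeaves_pos
  obtain ⟨l, hl⟩ := Nat.exists_eq_add_of_le' d.numLeaves_pos
  have h' := h i (by omega) a (mem_getD_reverse_normalLists ha (by omega) hi)
    j (by omega) b (mem_getD_reverse_normalLists hb (by omega) hj)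
    k (by omega) c (mem_getD_reverse_normalLists hc (by omega) hk)
    l (by omega) d (mem_getD_reverse_normalLists hd (by omega) hl)
  exact eq_of_isInstance h'.1 h'.2

theorem isNormal_normalForm {t : BinaryTree Unit} (ht : t.numLeaves ≤ 10) :
    isNormal (normalForm t) = true := by
  induction t with
  | nil => rfl
  | node _ l r ihl ihr =>
    have hl := (combRel_normalForm l).numLeaves_eq
    have hr := (combRel_normalForm r).numLeaves_eq
    simp only [numLeaves] at ht
    exact isNormal_normalMul (ihl (by omega)) (ihr (by omega)) (by omega)

theorem CombRel.normalForm_eq {s t : BinaryTree Unit} (h : CombRel s t) (hs : s.numLeaves ≤ 10) :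
    normalForm s = normalForm t := by
  induction h with
  | refl t => rfl
  | symm h ih => exact (ih (h.numLeaves_eq ▸ hs)).symm
  | trans h _ ih ih' => exact (ih hs).trans (ih' (h.numLeaves_eq ▸ hs))
  | node _ _ ih ih' =>
    simp only [numLeaves] at hs
    rw [normalForm, normalForm, ih (by omega), ih' (by omega)]
  | assoc a b c d =>
    simp only [numLeaves] at hs
    have ha := (combRel_normalForm a).numLeaves_eq
    have hb := (combRel_normalForm b).numLeaves_eq
    have hc := (combRel_normalForm c).numLeaves_eq
    have hd := (combRel_normalForm d).numLeaves_eq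
    exact normalMul_assoc (isNormal_normalForm (by omega)) (isNormal_normalForm (by omega))
      (isNormal_normalForm (by omega)) (isNormal_normalForm (by omega)) (by omega)

/-- Distinct normal trees with at most ten leaves are not congruent. -/
theorem CombRel.eq_of_isNormal {s t : BinaryTree Unit} (h : CombRel s t)
    (hs : isNormal s = true) (ht : isNormal t = true) (hsize : s.numLeaves ≤ 10) : s = t := by
  rw [← normalForm_eq_self hs, ← normalForm_eq_self ht, h.normalForm_eq hsize]

set_option maxRecDepth 100000 in
theorem normalTrees_spec : ∀ n < 10, (normalTrees n).Nodup ∧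
    ∀ t ∈ normalTrees n, isNormal t = true ∧ t.numLeaves = n + 1 := by
  decide +kernel

/-! ### Normal trees with at least eleven leaves -/

theorem isNormal_node_iff {l r : BinaryTree Unit} :
    isNormal (l △ r) = true ↔ isNormal l = true ∧ isNormal r = true ∧
      ∀ pq ∈ rules, isInstance pq.1 (l △ r) = false := by
  simp [isNormal, rootStep, and_assoc]

section NotNormal

/-! The left-hand side of the `n`-th rule of `rules` is not normal, for the values of `n` that are
needed to describe the large normal trees. -/

variable (a b c d e f g h : BinaryTree Unit)

theorem not_isNormal_rule₁ : ¬ isNormal (((a △ b) △ c) △ d) = true := by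
  simp [isNormal_node_iff, rules, isInstance]

theorem not_isNormal_rule₂ : ¬ isNormal ((a △ b △ c △ d) △ e) = true := by
  simp [isNormal_node_iff, rules, isInstance]

theorem not_isNormal_rule₃ : ¬ isNormal (a △ b △ (c △ d △ e) △ f) = true := by
  simp [isNormal_node_iff, rules, isInstance]

theorem not_isNormal_rule₄ : ¬ isNormal (a △ (b △ c △ d) △ e △ f) = true := by
  simp [isNormal_node_iff, rules, isInstance]

theorem not_isNormal_rule₆ : ¬ isNormal (a △ (b △ c) △ d △ e △ f △ g) = true := by
  simp [isNormal_node_iff, rules, isInstance]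

theorem not_isNormal_rule₇ : ¬ isNormal ((a △ (b △ c) △ d) △ e △ f △ g) = true := by
  simp [isNormal_node_iff, rules, isInstance]

theorem not_isNormal_rule₁₁ : ¬ isNormal ((a △ b △ c) △ d △ e △ f △ g △ h) = true := by
  simp [isNormal_node_iff, rules, isInstance]

end NotNormal

/-- The left subtree of a normal tree is a zigzag. The first two rules suffice for this. -/
theorem exists_zigzag_of_isNormal_node (l r : BinaryTree Unit) (h : isNormal (l △ r) = true) :
    ∃ i, l = zigzag true i := by
  match l with
  | nil => exact ⟨0, rfl⟩
  | node _ (node _ a b) c => exact absurd h (not_isNormal_rule₁ a b c r)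
  | node _ nil nil => exact ⟨1, rfl⟩
  | node _ nil (node _ a (node _ b c)) => exact absurd h (not_isNormal_rule₂ nil a b c r)
  | node _ nil (node _ a nil) =>
    have ha : isNormal (a △ nil) = true := (isNormal_node_iff.1 (isNormal_node_iff.1 h).1).2.1
    obtain ⟨i, rfl⟩ := exists_zigzag_of_isNormal_node a nil ha
    exact ⟨i + 2, rfl⟩

/-- The tree `x (x (… (x t)))` with `m` leaves `x` to the left of `t`. -/
def stem : ℕ → BinaryTree Unit → BinaryTree Unit
  | 0, t => t
  | m + 1, t => nil △ stem m t

theorem numLeaves_stem (m : ℕ) (t : BinaryTree Unit) :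
    (stem m t).numLeaves = m + t.numLeaves := by
  induction m with
  | zero => simp [stem]
  | succ m ih => simp [stem, ih]; omega

theorem rightDepth_stem (m : ℕ) (t : BinaryTree Unit) :
    rightDepth (stem m t) = m + rightDepth t := by
  induction m with
  | zero => simp [stem]
  | succ m ih => simp [stem, rightDepth, ih]; omega

theorem rigid_stem {m : ℕ} {t : BinaryTree Unit} (hm : 2 ≤ m) (ht : t ≠ nil) :
    rigid (stem m t) = false := by
  obtain ⟨m, rfl⟩ := Nat.exists_eq_add_of_le' hm
  cases m with
  | zero => simp [stem, rigid, ht]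
  | succ m => simp [stem, rigid]

/-- The two trees with three leaves: `x (x x)` for `true` and `(x x) x` for `false`. -/
def cherryComb : Bool → BinaryTree Unit
  | true => nil △ nil △ nil
  | false => (nil △ nil) △ nil

/-- The four normal trees with `m + 5` leaves that are not rigid, if `m` is at least `6`: the right
comb, the right comb with `(x x) x` in place of `x (x x)` at its end, and the trees with a left
subtree `x x` and a right subtree of one of these forms. -/
def combTree (p : Bool × Bool) (m : ℕ) : BinaryTree Unit :=
  if p.1 then (nil △ nil) △ stem m (cherryComb p.2) else stem (m + 2) (cherryComb p.2)

theorem numLeaves_combTree (p : Bool × Bool) (m : ℕ) : (combTree p m).numLeaves = m + 5 := by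
  rcases p with ⟨_ | _, _ | _⟩ <;> simp [combTree, numLeaves_stem, cherryComb] <;> omega

theorem rigid_combTree (p : Bool × Bool) {m : ℕ} (hm : 2 ≤ m) :
    rigid (combTree p m) = false := by
  have h (b : Bool) : cherryComb b ≠ nil := by cases b <;> simp [cherryComb]
  rcases p with ⟨_ | _, b⟩
  · exact rigid_stem (by omega) (h b)
  · simp [combTree, rigid, rigid_stem hm (h b)]

/-- The parities of the depths of the leftmost and of the rightmost leaf separate the four trees. -/
theorem eq_of_combRel_combTree {p q : Bool × Bool} {m : ℕ}
    (h : CombRel (combTree p m) (combTree q m)) : p = q := by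
  have hl := h.leftDepth_mod_two
  have hr := h.rightDepth_mod_two
  rcases p with ⟨_ | _, _ | _⟩ <;> rcases q with ⟨_ | _, _ | _⟩ <;>
    simp [combTree, stem, leftDepth, rightDepth, rightDepth_stem, cherryComb] at hl hr ⊢ <;> omega

set_option maxRecDepth 100000 in
theorem rigid_or_eq_combTree_of_mem_normalTrees : ∀ m < 9, 6 ≤ m → ∀ t ∈ normalTrees (m + 4),
    rigid t = true ∨ ∃ p, t = combTree p m := by
  decide +kernel

/-- The normal trees with at least eleven leaves. In the inductive step the tree is a product `l r`
of a zigzag `l` and a normal tree `r`. If `l` has at least four leaves, the rules confine `r` to be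
a zigzag; otherwise `r` is large enough for the induction hypothesis. -/
theorem rigid_or_eq_combTree {t : BinaryTree Unit} (ht : isNormal t = true) {m : ℕ} (hm : 6 ≤ m)
    (htm : t.numLeaves = m + 5) : rigid t = true ∨ ∃ p, t = combTree p m := by
  induction m using Nat.strong_induction_on generalizing t with
  | _ m ih =>
    -- Three consecutive cases start the induction, since `l` may have up to three leaves.
    rcases Nat.lt_or_ge m 9 with hm' | hm'
    · exact rigid_or_eq_combTree_of_mem_normalTrees m hm' hm t (mem_normalTrees ht htm)
    match t with
    | nil => simp at htm
    | node _ l r =>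
      have hr : isNormal r = true := (isNormal_node_iff.1 ht).2.1
      obtain ⟨i, rfl⟩ := exists_zigzag_of_isNormal_node l r ht
      simp only [numLeaves, numLeaves_zigzag] at htm
      by_cases hi : 3 ≤ i
      · left
        obtain ⟨i, rfl⟩ := Nat.exists_eq_add_of_le' hi
        match r with
        | nil => exact rigid_zigzag_node_zigzag (i + 3) 0
        | node _ a nil =>
          obtain ⟨j, rfl⟩ := exists_zigzag_of_isNormal_node a nil hr
          exact rigid_zigzag_node_zigzag (i + 3) (j + 1)
        | node _ a (node _ b c) =>
          exact absurd ht (not_isNormal_rule₇ nil nil (zigzag false i) nil a b c)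
      obtain ⟨k, hk⟩ : ∃ k, m = k + 7 + i := Nat.exists_eq_add_of_le' (by omega : 7 + i ≤ m)
        |>.imp fun _ h => by omega
      rcases ih (k + 6) (by omega) hr (by omega) (by omega) with hrig | ⟨⟨_ | _, b⟩, rfl⟩
      · left
        match r with
        | nil => simp at htm; omega
        | node _ r₁ r₂ =>
          obtain ⟨a, b, rfl, rfl⟩ := exists_zigzag_of_rigid_node hrig
          simp only [numLeaves, numLeaves_zigzag] at htm
          match b with
          | 0 => exact rigid_zigzag_node_zigzag i (a + 1)
          | b + 3 =>
            exact absurd ht (not_isNormal_rule₃ _ (zigzag true a) nil (zigzag true b) nil nil)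
          | 1 | 2 =>
            obtain ⟨a, rfl⟩ := Nat.exists_eq_add_of_le' (by omega : 2 ≤ a)
            exact absurd ht (not_isNormal_rule₄ _ nil (zigzag true a) nil _ nil)
      · right
        match i with
        | 0 => exact ⟨(false, b), by subst hk; rfl⟩
        | 1 => exact ⟨(true, b), by subst hk; rfl⟩
        | 2 =>
          exact absurd ht (not_isNormal_rule₁₁ nil nil nil nil nil nil nil
            (stem (k + 4) (cherryComb b)))
        | i + 3 => omega
      · exact absurd ht (not_isNormal_rule₆ _ nil nil nil nil nil (stem (k + 3) (cherryComb b)))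

/-! ### The components of `CAs 3` -/

/-- A family of trees that represents every class of trees with `n` leaves exactly once
enumerates the elements of arity `n`. -/
theorem finite_component_and_card {n : ℕ} {ι : Type} [Fintype ι] (f : ι → BinaryTree Unit)
    (hsize : ∀ i, (f i).numLeaves = n)
    (hsurj : ∀ t : BinaryTree Unit, t.numLeaves = n → ∃ i, CombRel t (f i))
    (hinj : ∀ i j, CombRel (f i) (f j) → i = j) :
    Finite ((CAs 3).component n) ∧ Nat.card ((CAs 3).component n) = Fintype.card ι := by
  let F : ι → (CAs 3).component n := fun i =>
    ⟨Quotient.mk (combCongruence 3).toSetoid (f i), hsize i⟩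
  have hF : Function.Bijective F := by
    constructor
    · intro i j h
      exact hinj i j (combCongruence_three_rel_iff.1 (Quotient.exact (congrArg Subtype.val h)))
    · rintro ⟨⟨t⟩, ht⟩
      obtain ⟨i, hi⟩ := hsurj t ht
      exact ⟨i, Subtype.ext (Quotient.sound (combCongruence_three_rel_iff.2 hi.symm))⟩
  exact ⟨Finite.of_surjective F hF.2, by
    rw [← Nat.card_eq_of_bijective F hF, Nat.card_eq_fintype_card]⟩

theorem finite_component_and_card_small {n : ℕ} (hn : n < 10) :
    Finite ((CAs 3).component (n + 1)) ∧
      Nat.card ((CAs 3).component (n + 1)) = (normalTrees n).length := by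
  obtain ⟨hnodup, hmem⟩ := normalTrees_spec n hn
  have hget (i : Fin (normalTrees n).length) := hmem _ (List.get_mem (normalTrees n) i)
  rw [← Fintype.card_fin (normalTrees n).length]
  refine finite_component_and_card (normalTrees n).get (fun i => (hget i).2) ?_ ?_
  · intro t ht
    obtain ⟨s, hs, hts, -⟩ := exists_isNormal t
    obtain ⟨i, rfl⟩ := List.get_of_mem (mem_normalTrees hs (hts.numLeaves_eq ▸ ht))
    exact ⟨i, hts⟩
  · intro i j hij
    exact hnodup.injective_get
      (hij.eq_of_isNormal (hget i).1 (hget j).1 ((hget i).2.trans_le (by omega)))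

/-- The classes are those of the `m + 4` rigid trees and of the four trees `combTree p m`. -/
theorem finite_component_and_card_large {m : ℕ} (hm : 6 ≤ m) :
    Finite ((CAs 3).component (m + 5)) ∧ Nat.card ((CAs 3).component (m + 5)) = m + 8 := by
  rw [show m + 8 = Fintype.card (Fin (m + 4) ⊕ Bool × Bool) by simp]
  refine finite_component_and_card
    (Sum.elim (fun i => zigzag true i △ zigzag false (m + 3 - i)) fun p => combTree p m) ?_ ?_ ?_
  · rintro (i | p)
    · simp [numLeaves_zigzag]
      omega
    · exact numLeaves_combTree p m
  · intro t ht
    obtain ⟨s, hs, hts, -⟩ := exists_isNormal t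
    have hsm := hts.numLeaves_eq ▸ ht
    rcases rigid_or_eq_combTree hs hm hsm with h | ⟨p, rfl⟩
    · match s with
      | nil => simp at hsm
      | node _ l r =>
        obtain ⟨i, j, rfl, rfl⟩ := exists_zigzag_of_rigid_node h
        simp only [numLeaves, numLeaves_zigzag] at hsm
        obtain rfl : j = m + 3 - i := by omega
        exact ⟨.inl ⟨i, by omega⟩, hts⟩
    · exact ⟨.inr p, hts⟩
  · rintro (i | p) (j | q) h
    · have h' := h.eq_of_rigid (rigid_zigzag_node_zigzag _ _)
      simp only [Sum.elim_inl, node.injEq, true_and] at h'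
      have h'' := congrArg numLeaves h'.1
      simp only [numLeaves_zigzag] at h''
      exact congrArg _ (Fin.ext (by omega))
    · have h' := h.eq_of_rigid (rigid_zigzag_node_zigzag _ _)
      have h'' := rigid_combTree q (by omega : 2 ≤ m)
      rw [← Sum.elim_inr (fun i : Fin (m + 4) => zigzag true i △ zigzag false (m + 3 - i))
        (fun p => combTree p m), ← h'] at h''
      simp [rigid_zigzag_node_zigzag] at h''
    · have h' := h.symm.eq_of_rigid (rigid_zigzag_node_zigzag _ _)
      have h'' := rigid_combTree p (by omega : 2 ≤ m)
      rw [← Sum.elim_inr (fun i : Fin (m + 4) => zigzag true i △ zigzag false (m + 3 - i))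
        (fun p => combTree p m), ← h'] at h''
      simp [rigid_zigzag_node_zigzag] at h''
    · exact congrArg _ (eq_of_combRel_combTree h)

theorem finite_component_zero_and_card :
    Finite ((CAs 3).component 0) ∧ Nat.card ((CAs 3).component 0) = 0 := by
  have : IsEmpty ((CAs 3).component 0) :=
    ⟨fun x => absurd ((CAs 3).one_le_arity x.1) (by rw [x.2]; omega)⟩
  exact ⟨inferInstance, Nat.card_of_isEmpty⟩

set_option maxRecDepth 100000 in
theorem length_normalTrees :
    (List.range 10).map (fun n => (normalTrees n).length) = [1, 1, 2, 4, 8, 14, 20, 19, 16, 14] := by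
  decide +kernel

theorem finite_component (n : ℕ) : Finite ((CAs 3).component n) := by
  rcases n with _ | n
  · exact finite_component_zero_and_card.1
  rcases Nat.lt_or_ge n 10 with hn | hn
  · exact (finite_component_and_card_small hn).1
  · obtain ⟨m, rfl⟩ := Nat.exists_eq_add_of_le' (by omega : 4 ≤ n)
    exact (finite_component_and_card_large (by omega)).1

theorem card_component_of_le {n : ℕ} (hn : 11 ≤ n) :
    Nat.card ((CAs 3).component n) = n + 3 := by
  obtain ⟨m, rfl⟩ := Nat.exists_eq_add_of_le' (by omega : 5 ≤ n)
  exact (finite_component_and_card_large (by omega)).2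

end BinaryTree

/-! ### The Hilbert series -/

open BinaryTree PowerSeries in
/-- The cardinalities of the components are `n + 3` up to finitely many corrections. -/
theorem hilbertSeries_CAs_three :
    (CAs 3).hilbertSeries = PowerSeries.mk (fun n => (n : ℚ) + 3) +
      (-C 3 - C 3 * X ^ 1 - C 4 * X ^ 2 - C 4 * X ^ 3 - C 3 * X ^ 4 + C 5 * X ^ 6 + C 10 * X ^ 7
        + C 8 * X ^ 8 + C 4 * X ^ 9 + X ^ 10) := by
  ext n
  rw [NSOperad.hilbertSeries, coeff_mk]
  rcases Nat.lt_or_ge n 11 with hn | hn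
  · have hlen := length_normalTrees
    simp only [List.range_succ, List.range_zero, List.nil_append, List.cons_append, List.map_cons,
      List.map_nil, List.cons.injEq, and_true] at hlen
    rcases n with _ | n
    · rw [finite_component_zero_and_card.2]
      simp
    rw [(finite_component_and_card_small (by omega)).2]
    have hn' : n < 10 := by omega
    interval_cases n <;> norm_num [hlen, coeff_X_pow, coeff_C]
  · have hn' (k : ℕ) (hk : k < 11) : n ≠ k := by omega
    rw [card_component_of_le hn]
    simp [coeff_X_pow, coeff_X, coeff_C, hn']

theorem mainTheorem6 :
    (∀ n : ℕ, Finite ((CAs 3).component n)) ∧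
    (CAs 3).hilbertSeries =
      (PowerSeries.X : PowerSeries ℚ) * ((1 - PowerSeries.X) ^ 2)⁻¹ *
        (1 - PowerSeries.X + PowerSeries.X ^ 2 + PowerSeries.X ^ 3 + 2 * PowerSeries.X ^ 4
          + 2 * PowerSeries.X ^ 5 - 7 * PowerSeries.X ^ 7 - 2 * PowerSeries.X ^ 8
          + PowerSeries.X ^ 9 + 2 * PowerSeries.X ^ 10 + PowerSeries.X ^ 11) ∧
    (∀ n : ℕ, 11 ≤ n → Nat.card ((CAs 3).component n) = n + 3) ∧
    (∀ (K : Type u) [Field K] [CharZero K] (n : ℕ), 11 ≤ n →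
      Module.finrank K ((CAs 3).component n →₀ K) = n + 3) := by
  refine ⟨BinaryTree.finite_component, ?_, fun n hn => BinaryTree.card_component_of_le hn,
    fun K _ _ n hn => ?_⟩
  · rw [← mul_right_comm, PowerSeries.eq_mul_inv_iff_mul_eq (by simp), hilbertSeries_CAs_three]
    have h1 : (PowerSeries.mk 1 : PowerSeries ℚ) * (1 - PowerSeries.X) = 1 :=
      PowerSeries.mk_one_mul_one_sub_eq_one ℚ
    have h2 : PowerSeries.mk (fun n => (n : ℚ) + 3) * (1 - PowerSeries.X) =
        PowerSeries.mk 1 + PowerSeries.C 2 := by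
      ext n
      cases n with
      | zero => simp; norm_num
      | succ n => simp [mul_sub, PowerSeries.coeff_succ_mul_X]
    simp only [map_ofNat] at h2 ⊢
    linear_combination (1 - PowerSeries.X) * h2 + h1
  · have := BinaryTree.finite_component n
    have := Fintype.ofFinite ((CAs 3).component n)
    rw [Module.finrank_finsupp_self, ← Nat.card_eq_fintype_card,
      BinaryTree.card_component_of_le hn]
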